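/- Let $E_1=\prod_{j\ge 1}(1-q^j)$. For a rational number $t$ define the fractional partition function $p_t(n)$ by $\sum_{n\ge 0}p_t(n)q^n=E_1^{\,t}$, where $E_1^{\,t}=\sum_{i\ge 0}\binom{t}{i}(E_1-1)^i$ is the rational power of a power series with constant term $1$. For a rational number $x$ and a positive integer $m$, the congruence $x\equiv 0\pmod m$ means that the numerator of $x$ (in lowest terms) is divisible by $m$. Theorem. Let $k>1$ and $s\ge 1$ be integers with $s\le\lfloor k/2\rfloor$. Then, for all $n\ge 0$, the following hold. (1) For every integer $b$ coprime to $3$ and every $r\in\{1,2\}$, $$p_{-(3^{k}-6b)/b}\Big(3^{2s}n+3^{2s-1}r+\frac{3^{2s}-1}{4}\Big)\equiv 0\pmod{3^k}.$$ (2) For every integer $b$ coprime to $5$ and every $r\in\{0,2,3,4\}$, $$p_{-(5^{k}-8b)/b}\Big(5^{2s}n+5^{2s-1}r+\frac{2\cdot 5^{2s-1}-1}{3}\Big)\equiv 0\pmod{5^k}.$$ (3) For every integer $b$ coprime to $5$ and every $r\in\{0,1,3,4\}$, $$p_{-(5^{k}-14b)/b}\Big(5^{2s}n+5^{2s-1}r+\frac{11\cdot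 5^{2s-1}-7}{12}\Big)\equiv 0\pmod{5^k}.$$ (4) For every integer $b$ coprime to $7$ and every $r\in\{0,2,3,4,5,6\}$, $$p_{-(7^{k}-6b)/b}\Big(7^{2s}n+7^{2s-1}r+\frac{3\cdot 7^{2s-1}-1}{4}\Big)\equiv 0\pmod{7^k}.$$ -/

import Mathlib

open scoped PowerSeries.WithPiTopology

noncomputable section

namespace FractionalPartition

/-- `E₁ = (q; q)_∞ = ∏_{j ≥ 1} (1 - q ^ j)`, as a formal power series in `q` over `ℚ`; the infinite
product is taken in the topology of coefficientwise convergence (see `multipliable_eulerProduct`). -/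
def eulerProduct : PowerSeries ℚ :=
  ∏' j : ℕ, (1 - (PowerSeries.X : PowerSeries ℚ) ^ (j + 1))

/-- The product defining `E₁` converges. -/
theorem multipliable_eulerProduct :
    Multipliable fun j : ℕ => (1 - (PowerSeries.X : PowerSeries ℚ) ^ (j + 1)) :=
  PowerSeries.WithPiTopology.multipliable_one_sub_X_pow ℚ

theorem constantCoeff_eulerProduct : PowerSeries.constantCoeff eulerProduct = 1 := by
  have h := multipliable_eulerProduct.map_tprod
    (PowerSeries.constantCoeff (R := ℚ)) (PowerSeries.WithPiTopology.continuous_constantCoeff ℚ)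
  rw [eulerProduct, h]
  simp

/-- `E₁ - 1` has no constant term, so it may be substituted into any power series. -/
theorem hasSubst_eulerProduct_sub_one : PowerSeries.HasSubst (eulerProduct - 1) :=
  PowerSeries.HasSubst.of_constantCoeff_zero' (by simp [constantCoeff_eulerProduct])

/-- The rational power `E₁ ^ t = ∑_{i ≥ 0} binom(t, i) (E₁ - 1) ^ i`: the binomial series
`(1 + X) ^ t` evaluated at `X = E₁ - 1`. -/
def eulerPow (t : ℚ) : PowerSeries ℚ :=
  (PowerSeries.binomialSeries ℚ t).subst (eulerProduct - 1)

/-- The fractional partition function `p_t(n)`, given by `∑_{n ≥ 0} p_t(n) q ^ n = E₁ ^ t`. -/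
def fracPartition (t : ℚ) (n : ℕ) : ℚ :=
  PowerSeries.coeff n (eulerPow t)

/-- The congruence `x ≡ 0 (mod m)` for a rational number `x`: the numerator of `x`, written in
lowest terms, is divisible by `m`. -/
def CongrZero (x : ℚ) (m : ℕ) : Prop :=
  (m : ℤ) ∣ x.num

end FractionalPartition

end

/-! Split the exponent as `d + t` with `t = -p^k / b`, so that E₁^(d+t) = E₁^d · E₁^t with `d` equal
to 6, 8, 14, 6. Let a(i) and c(j) be the coefficients of the two factors.

Differentiating, n·c(n) is `t` times a `p`-integral number, hence divisible by `p^k`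
(`padicNorm_natCast_mul_coeff_eulerPow_le`). On the other side, E₁^d has a lacunary structure: for
suitable `u`, `w`, a(i) vanishes when v_p(ui + w) is odd, and is always divisible by the `p`-part of
ui + w.

These facts combine in `padicNorm_coeff_mul_le`. If i + j = N and v_p(uN + w) is odd, either v_p(j)
≤ v_p(ui + w), and a(i)c(j) inherits the divisibility of j·c(j), or ui + w has the same valuation as
uN + w, and a(i) = 0. The arguments in the theorem are numbers N with uN + w equal to `p^(2s-1)`
times a number prime to `p`.

The structure of E₁^6 for p ≡ 3 mod 4 comes from Jacobi's formula for E₁^3, which turns 2(4n + 1)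
into a sum of two squares. For E₁^8 and E₁^14 at p = 5, Ramanujan's 5-dissection of E₁ gives a
recursion from n to l with un + w = 25(ul + w). -/

namespace FractionalPartition

/-! ### Gaussian binomials and the finite `q`-binomial theorem -/

section GaussBinomial

variable {R : Type*} [CommRing R]

/-- The Gaussian binomial coefficient `[l + m choose l]` in the variable `q`. -/
def gaussBinom (q : R) : ℕ → ℕ → R
  | 0, _ => 1
  | _ + 1, 0 => 1
  | l + 1, m + 1 => gaussBinom q (l + 1) m + q ^ (m + 1) * gaussBinom q l (m + 1)

/-- The finite product `∏_{1 ≤ i ≤ n} (1 - q ^ i)`. -/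
def qFactorial (q : R) (n : ℕ) : R := ∏ i ∈ Finset.range n, (1 - q ^ (i + 1))

theorem qFactorial_succ (q : R) (n : ℕ) :
    qFactorial q (n + 1) = qFactorial q n * (1 - q ^ (n + 1)) :=
  Finset.prod_range_succ _ _

@[simp] theorem qFactorial_zero (q : R) : qFactorial q 0 = 1 := Finset.prod_range_zero _

@[simp] theorem gaussBinom_zero_left (q : R) (m : ℕ) : gaussBinom q 0 m = 1 := by
  simp [gaussBinom]

@[simp] theorem gaussBinom_zero_right (q : R) (l : ℕ) : gaussBinom q l 0 = 1 := by
  cases l <;> simp [gaussBinom]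

theorem gaussBinom_succ_succ (q : R) (l m : ℕ) :
    gaussBinom q (l + 1) (m + 1) =
      gaussBinom q (l + 1) m + q ^ (m + 1) * gaussBinom q l (m + 1) := by
  simp [gaussBinom]

theorem gaussBinom_mul_qFactorial (q : R) (l m : ℕ) :
    gaussBinom q l m * (qFactorial q l * qFactorial q m) = qFactorial q (l + m) := by
  induction l generalizing m with
  | zero => simp
  | succ l ihl =>
    induction m with
    | zero => simp
    | succ m ihm =>
      have h1 := ihl (m + 1)
      rw [show l + 1 + (m + 1) = (l + 1 + m) + 1 by ring, qFactorial_succ q (l + 1 + m),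
        gaussBinom_succ_succ, ← ihm]
      rw [show l + (m + 1) = l + 1 + m by ring, ← ihm] at h1
      simp only [qFactorial_succ] at h1 ihm ⊢
      linear_combination q ^ (m + 1) * (1 - q ^ (l + 1)) * h1

/-- The homogeneous Gauss binomial theorem. -/
theorem prod_add_mul_pow (q x y : R) (n : ℕ) :
    ∏ i ∈ Finset.range n, (y + x * q ^ i) =
      ∑ a ∈ Finset.HasAntidiagonal.antidiagonal n,
        q ^ (a.1.choose 2) * gaussBinom q a.1 a.2 * x ^ a.1 * y ^ a.2 := by
  induction n with
  | zero => simp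
  | succ n ih =>
    rw [Finset.prod_range_succ, ih]
    cases n with
    | zero => simp [Finset.Nat.antidiagonal_succ]
    | succ n =>
    rw [mul_add]
    nth_rewrite 1 [Finset.Nat.sum_antidiagonal_succ (n := n)]
    rw [Finset.Nat.sum_antidiagonal_succ' (n := n), Finset.Nat.sum_antidiagonal_succ (n := n + 1),
      Finset.Nat.sum_antidiagonal_succ' (n := n)]
    simp only [add_mul, Finset.sum_mul]
    have h (a : ℕ × ℕ) (ha : a ∈ Finset.HasAntidiagonal.antidiagonal n) :
        q ^ (a.1 + 1).choose 2 * gaussBinom q (a.1 + 1) (a.2 + 1) * x ^ (a.1 + 1) * y ^ (a.2 + 1) =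
        q ^ (a.1 + 1).choose 2 * gaussBinom q (a.1 + 1) a.2 * x ^ (a.1 + 1) * y ^ a.2 * y +
        q ^ (a.1).choose 2 * gaussBinom q a.1 (a.2 + 1) * x ^ a.1 * y ^ (a.2 + 1) *
          (x * q ^ (n + 1)) := by
      rw [← Finset.HasAntidiagonal.mem_antidiagonal.mp ha, gaussBinom_succ_succ,
        Nat.choose_succ_left _ _ (by norm_num)]
      simp
      ring
    rw [Finset.sum_congr rfl h, Finset.sum_add_distrib]
    simp [Nat.choose_succ_left (n + 1) 2]
    ring

end GaussBinomial

/-! ### A finite form of Jacobi's identity -/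

section FiniteJacobi

variable {R : Type*} [CommRing R]

theorem map_gaussBinom {S : Type*} [CommRing S] (f : R →+* S) (q : R) (l m : ℕ) :
    f (gaussBinom q l m) = gaussBinom (f q) l m := by
  induction l generalizing m with
  | zero => simp
  | succ l ihl =>
    induction m with
    | zero => simp
    | succ m ihm => simp [gaussBinom_succ_succ, ihm, ihl]

theorem prod_pow_sub_pow (q : R) (n : ℕ) :
    ∏ i ∈ Finset.range n, (q ^ n - q ^ i) = (-1) ^ n * q ^ n.choose 2 * qFactorial q n := by
  induction n with
  | zero => simp
  | succ n ih =>
    have (i : ℕ) : q ^ (n + 1) - q ^ (i + 1) = q * (q ^ n - q ^ i) := by ring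
    simp only [Finset.prod_range_succ', this, Finset.prod_mul_distrib, ih, qFactorial_succ,
      Nat.choose_succ_left n 2 two_pos]
    simp
    ring

/-- The derivative at `z = 1` of the Gauss binomial expansion of `∏_{i ≤ 2 n} (q ^ n - z q ^ i)`. -/
theorem sum_antidiagonal_mul_gaussBinom (q : R) (n : ℕ) :
    ∑ a ∈ Finset.HasAntidiagonal.antidiagonal (2 * n + 1),
        (-1) ^ a.1 * (a.1 : R) * q ^ (a.1.choose 2 + n * a.2) * gaussBinom q a.1 a.2 =
      (-1) ^ (n + 1) * q ^ (n + n.choose 2 + n * n) * qFactorial q n ^ 2 := by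
  have h := congrArg (fun P => (Polynomial.derivative P).eval 1)
    (prod_add_mul_pow (Polynomial.C q) (-Polynomial.X) (Polynomial.C (q ^ n)) (2 * n + 1))
  have e : 2 * n + 1 = n + (n + 1) := by ring
  have hL : ∏ i ∈ Finset.range n, (q ^ n - q ^ (n + (i + 1))) = q ^ (n * n) * qFactorial q n := by
    have (i : ℕ) : q ^ n - q ^ (n + (i + 1)) = q ^ n * (1 - q ^ (i + 1)) := by ring
    simp only [this, Finset.prod_mul_distrib, qFactorial]
    simp [pow_mul]
  simp only [Polynomial.derivative_sum, Polynomial.eval_finsetSum] at h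
  trans ∑ b ∈ Finset.HasAntidiagonal.antidiagonal (2 * n + 1), Polynomial.eval 1
      (Polynomial.derivative (Polynomial.C q ^ b.1.choose 2 * gaussBinom (Polynomial.C q) b.1 b.2 *
        (-Polynomial.X) ^ b.1 * Polynomial.C (q ^ n) ^ b.2))
  · refine Finset.sum_congr rfl fun a _ => ?_
    have : Polynomial.C q ^ a.1.choose 2 * gaussBinom (Polynomial.C q) a.1 a.2 *
        (-Polynomial.X) ^ a.1 * Polynomial.C (q ^ n) ^ a.2 = Polynomial.C (q ^ a.1.choose 2 *
          gaussBinom q a.1 a.2 * (-1) ^ a.1 * (q ^ n) ^ a.2) * Polynomial.X ^ a.1 := by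
      rw [← map_gaussBinom, neg_pow]
      simp
      ring
    rw [this, Polynomial.derivative_C_mul_X_pow]
    simp
    ring
  -- The factor with index i = n is q^n (1 - z), a zero at z = 1, so the derivative there keeps only
  -- the product of the other factors.
  · rw [← h, e, Finset.prod_range_add, Finset.prod_range_succ']
    have : Polynomial.C (q ^ n) + -Polynomial.X * Polynomial.C q ^ (n + 0) =
      Polynomial.C (q ^ n) * (1 - Polynomial.X) := by simp; ring
    rw [this]
    simp only [Polynomial.derivative_mul, Polynomial.eval_add, Polynomial.eval_mul,
      Polynomial.eval_prod]
    simp only [Polynomial.eval_sub, Polynomial.eval_neg,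
      Polynomial.eval_one, Polynomial.eval_X, Polynomial.eval_C, Polynomial.derivative_sub,
      Polynomial.derivative_one, Polynomial.derivative_X, Polynomial.derivative_C,
      Polynomial.eval_pow, sub_self, mul_zero, zero_add, Polynomial.eval_zero,
      neg_mul, one_mul, ← sub_eq_add_neg, prod_pow_sub_pow, hL]
    ring

theorem choose_two_add_mul {j n : ℕ} (h : j ≤ n) :
    (n + 1 + j).choose 2 + n * (n - j) = n + n.choose 2 + n * n + (j + 1).choose 2 := by
  obtain ⟨e, rfl⟩ := Nat.exists_eq_add_of_le h
  rw [← Nat.cast_inj (R := ℚ), Nat.add_sub_cancel_left]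
  push_cast [Nat.cast_choose_two]
  ring

theorem choose_two_sub_add_mul {j n : ℕ} (h : j ≤ n) :
    (n - j).choose 2 + n * (n + 1 + j) = n + n.choose 2 + n * n + (j + 1).choose 2 := by
  obtain ⟨e, rfl⟩ := Nat.exists_eq_add_of_le h
  rw [← Nat.cast_inj (R := ℚ), Nat.add_sub_cancel_left]
  push_cast [Nat.cast_choose_two]
  ring

/-- A finite form of Jacobi's identity for the cube of Euler's product. -/
theorem qFactorial_sq [IsDomain R] {q : R} (hq : q ≠ 0) (n : ℕ) :
    qFactorial q n ^ 2 = ∑ j ∈ Finset.range (n + 1), (-1) ^ j * q ^ (j + 1).choose 2 *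
      ((n + 1 + j : ℕ) * gaussBinom q (n + 1 + j) (n - j) -
        (n - j : ℕ) * gaussBinom q (n - j) (n + 1 + j)) := by
  have h := sum_antidiagonal_mul_gaussBinom q n
  -- Pair the indices n - j and n + 1 + j: their powers of `q` agree and their signs are opposite.
  rw [Finset.Nat.sum_antidiagonal_eq_sum_range_succ_mk, show (2 * n + 1).succ = n + 1 + (n + 1) by
    omega, Finset.sum_range_add, ← Finset.sum_range_reflect, ← Finset.sum_add_distrib] at h
  apply mul_left_cancel₀ (pow_ne_zero (n + n.choose 2 + n * n) hq)
  apply mul_left_cancel₀ (pow_ne_zero (n + 1) (neg_ne_zero.mpr (one_ne_zero (α := R))))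
  rw [← mul_assoc, ← h, Finset.mul_sum, Finset.mul_sum]
  refine Finset.sum_congr rfl fun j hj => ?_
  have hj : j ≤ n := by simpa [Nat.lt_succ_iff] using hj
  rw [show n + 1 - 1 - j = n - j by omega, show 2 * n + 1 - (n - j) = n + 1 + j by omega,
    show 2 * n + 1 - (n + 1 + j) = n - j by omega, choose_two_add_mul hj, choose_two_sub_add_mul hj]
  have h1 : (-1 : R) ^ (n - j) = (-1) ^ (n + j) := by
    rw [← Nat.sub_add_cancel hj]
    simp [pow_add, mul_assoc, ← mul_pow]
  rw [h1]
  ring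

end FiniteJacobi

/-! ### Jacobi's identity for E₁^3 and the coefficients of E₁^6 -/

section Jacobi

open PowerSeries

theorem coeff_qFactorial_X {d m : ℕ} (h : d ≤ m) :
    coeff d (qFactorial (X : PowerSeries ℚ) m) = coeff d eulerProduct := by
  have hc (m : ℕ) (h : d ≤ m) : coeff d (qFactorial (X : PowerSeries ℚ) m) =
      coeff d (qFactorial (X : PowerSeries ℚ) d) := by
    induction m, h using Nat.le_induction with
    | base => rfl
    | succ m hm ih =>
      rw [qFactorial_succ, mul_sub, mul_one, map_sub, ih, coeff_mul_X_pow', if_neg (by omega),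
        sub_zero]
  have h1 : Filter.Tendsto (fun m => coeff d (qFactorial (X : PowerSeries ℚ) m)) Filter.atTop
      (nhds (coeff d eulerProduct)) :=
    ((PowerSeries.WithPiTopology.continuous_coeff ℚ d).tendsto _).comp
      multipliable_eulerProduct.hasProd.tendsto_prod_nat
  have h2 : Filter.Tendsto (fun m => coeff d (qFactorial (X : PowerSeries ℚ) m)) Filter.atTop
      (nhds (coeff d (qFactorial (X : PowerSeries ℚ) d))) :=
    tendsto_atTop_of_eventually_const hc
  rw [hc m h, tendsto_nhds_unique h1 h2]

theorem X_pow_dvd_eulerProduct_sub_qFactorial {k m : ℕ} (h : k ≤ m) :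
    (X : PowerSeries ℚ) ^ (k + 1) ∣ eulerProduct - qFactorial X m := by
  rw [X_pow_dvd_iff]
  intro d hd
  rw [map_sub, coeff_qFactorial_X (by omega), sub_self]

/-- In the quotient formula (q)_(l+m) / ((q)_l (q)_m) each factor agrees with E₁ up to degree `k`,
which leaves 1/E₁. -/
theorem X_pow_dvd_eulerProduct_mul_gaussBinom_sub_one {k l m : ℕ} (hl : k ≤ l) (hm : k ≤ m) :
    (X : PowerSeries ℚ) ^ (k + 1) ∣ eulerProduct * gaussBinom X l m - 1 := by
  have hu : IsUnit eulerProduct :=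
    isUnit_iff_constantCoeff.mpr (by rw [constantCoeff_eulerProduct]; exact isUnit_one)
  rw [← hu.dvd_mul_left]
  have h1 := X_pow_dvd_eulerProduct_sub_qFactorial hl
  have h2 := X_pow_dvd_eulerProduct_sub_qFactorial hm
  have h3 := X_pow_dvd_eulerProduct_sub_qFactorial (show k ≤ l + m by omega)
  have h := gaussBinom_mul_qFactorial (X : PowerSeries ℚ) l m
  have := dvd_sub (dvd_add (h1.mul_left (gaussBinom X l m * eulerProduct))
    (h2.mul_left (gaussBinom X l m * qFactorial X l))) h3
  convert this using 1
  linear_combination h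

/-- Jacobi's identity `E₁ ^ 3 = ∑ (-1) ^ j (2 j + 1) q ^ (j (j + 1) / 2)`, modulo `q ^ (n + 1)`. -/
theorem X_pow_dvd_eulerProduct_pow_three_sub (n : ℕ) :
    (X : PowerSeries ℚ) ^ (n + 1) ∣ eulerProduct ^ 3 -
      ∑ j ∈ Finset.range (n + 1), C ((-1) ^ j * (2 * j + 1) : ℚ) * X ^ (j + 1).choose 2 := by
  have h1 := X_pow_dvd_eulerProduct_sub_qFactorial (le_refl n)
  have h2 : (X : PowerSeries ℚ) ^ (n + 1) ∣ eulerProduct * qFactorial X n ^ 2 -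
      ∑ j ∈ Finset.range (n + 1), C ((-1) ^ j * (2 * j + 1) : ℚ) * X ^ (j + 1).choose 2 := by
    rw [qFactorial_sq X_ne_zero, Finset.mul_sum, ← Finset.sum_sub_distrib]
    refine Finset.dvd_sum fun j hj => ?_
    have hj : j ≤ n := by simpa [Nat.lt_succ_iff] using hj
    have ha := X_pow_dvd_eulerProduct_mul_gaussBinom_sub_one
      (show n - j ≤ n + 1 + j by omega) (le_refl (n - j))
    have hb := X_pow_dvd_eulerProduct_mul_gaussBinom_sub_one
      (le_refl (n - j)) (show n - j ≤ n + 1 + j by omega)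
    have hc := dvd_sub (ha.mul_left ((n + 1 + j : ℕ) : PowerSeries ℚ))
      (hb.mul_left ((n - j : ℕ) : PowerSeries ℚ))
    -- The Gaussian binomials are known only up to degree n - j; the power of `X` in front makes up
    -- the missing `j`. The weights leave (n + 1 + j) - (n - j) = 2j + 1.
    have hd : (X : PowerSeries ℚ) ^ (n + 1) ∣ X ^ (j + 1).choose 2 * X ^ (n - j + 1) := by
      rw [← pow_add]
      refine pow_dvd_pow _ ?_
      have : j ≤ (j + 1).choose 2 := by
        rw [Nat.choose_succ_left _ _ two_pos]
        simp
      omega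
    refine (hd.trans (mul_dvd_mul_left _ hc)).trans (Dvd.intro_left (C ((-1) ^ j)) ?_)
    push_cast [Nat.cast_sub hj]
    simp only [map_mul, map_pow, map_neg, map_one, map_add, map_natCast, map_ofNat]
    ring
  -- E₁^3 - E₁ (q)_n^2 = E₁ (E₁ + (q)_n)(E₁ - (q)_n).
  have h3 := (h1.mul_left (eulerProduct * (eulerProduct + qFactorial X n))).add h2
  convert h3 using 1
  ring

theorem coeff_eulerProduct_pow_three {d n : ℕ} (h : d ≤ n) :
    coeff d (eulerProduct ^ 3) = coeff d (∑ j ∈ Finset.range (n + 1),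
      C ((-1) ^ j * (2 * j + 1) : ℚ) * X ^ (j + 1).choose 2) := by
  rw [← sub_eq_zero, ← map_sub]
  exact X_pow_dvd_iff.mp (X_pow_dvd_eulerProduct_pow_three_sub n) d (by omega)

theorem coeff_eulerProduct_pow_six (n : ℕ) :
    coeff n (eulerProduct ^ 6) = ∑ i ∈ Finset.range (n + 1), ∑ j ∈ Finset.range (n + 1),
      if (i + 1).choose 2 + (j + 1).choose 2 = n then
        (-1) ^ (i + j) * ((2 * i + 1) * (2 * j + 1) : ℚ) else 0 := by
  have h := X_pow_dvd_eulerProduct_pow_three_sub n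
  set S := ∑ j ∈ Finset.range (n + 1), C ((-1) ^ j * (2 * j + 1) : ℚ) * X ^ (j + 1).choose 2
    with hS
  have h2 := X_pow_dvd_iff.mp (h.mul_right (eulerProduct ^ 3 + S)) n (by omega)
  have h3 : (eulerProduct ^ 3 - S) * (eulerProduct ^ 3 + S) = eulerProduct ^ 6 - S * S := by ring
  rw [h3, map_sub, sub_eq_zero] at h2
  rw [h2, hS, Finset.sum_mul_sum, map_sum]
  refine Finset.sum_congr rfl fun i _ => ?_
  rw [map_sum]
  refine Finset.sum_congr rfl fun j _ => ?_
  rw [mul_mul_mul_comm, ← map_mul, ← pow_add, coeff_C_mul, coeff_X_pow]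
  simp only [eq_comm (a := n)]
  split_ifs
  · ring
  · ring

end Jacobi

/-! ### `p`-integrality of rational powers and the convolution argument -/

section Integrality

open PowerSeries

variable (p : ℕ) [Fact p.Prime]

/-- The ring of rational numbers whose denominator is prime to `p`. -/
noncomputable def padicIntegral : Subring ℚ := (PadicInt.subring p).comap (Rat.castHom ℚ_[p])

variable {p}

theorem mem_padicIntegral {x : ℚ} : x ∈ padicIntegral p ↔ padicNorm p x ≤ 1 := by
  rw [← Rat.cast_le (K := ℝ), ← Padic.eq_padicNorm, Rat.cast_one]
  rfl

/-- ℤ_p is a binomial ring, and `Ring.choose` commutes with the maps of ℤ_p and ℚ into ℚ_p. -/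
theorem choose_mem_padicIntegral {t : ℚ} (ht : t ∈ padicIntegral p) (n : ℕ) :
    Ring.choose t n ∈ padicIntegral p := by
  let x : ℤ_[p] := ⟨(t : ℚ_[p]), ht⟩
  have h1 := Ring.map_choose (PadicInt.Coe.ringHom (p := p)) x n
  have h2 := Ring.map_choose (Rat.castHom ℚ_[p]) t n
  change Rat.castHom ℚ_[p] _ ∈ PadicInt.subring p
  rw [h2]
  exact h1 ▸ (Ring.choose x n).2

theorem coeff_mul_mem {S : Subring ℚ} {f g : PowerSeries ℚ} (hf : ∀ n, coeff n f ∈ S)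
    (hg : ∀ n, coeff n g ∈ S) (n : ℕ) : coeff n (f * g) ∈ S := by
  rw [coeff_mul]
  exact S.sum_mem fun a _ => S.mul_mem (hf _) (hg _)

theorem coeff_pow_mem {S : Subring ℚ} {f : PowerSeries ℚ} (hf : ∀ n, coeff n f ∈ S) (d n : ℕ) :
    coeff n (f ^ d) ∈ S := by
  induction d generalizing n with
  | zero =>
    rw [pow_zero, coeff_one]
    split_ifs
    · exact S.one_mem
    · exact S.zero_mem
  | succ d ih => exact pow_succ f d ▸ coeff_mul_mem ih hf n

theorem eulerProduct_eq_pentagonalSeries : eulerProduct = pentagonalSeries ℚ :=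
  PowerSeries.WithPiTopology.tprod_one_sub_X_pow ℚ

theorem coeff_eulerProduct_mem (S : Subring ℚ) (n : ℕ) : coeff n eulerProduct ∈ S := by
  rw [eulerProduct_eq_pentagonalSeries]
  by_cases h : n ∈ Set.range pentagonal
  · obtain ⟨k, rfl⟩ := h
    rw [coeff_pentagonalSeries_pentagonal]
    exact intCast_mem S _
  · rw [coeff_pentagonalSeries_eq_zero ℚ h]
    exact S.zero_mem

theorem coeff_eulerPow_mem {t : ℚ} (ht : t ∈ padicIntegral p) (n : ℕ) :
    coeff n (eulerPow t) ∈ padicIntegral p := by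
  rw [eulerPow, coeff_subst' hasSubst_eulerProduct_sub_one]
  refine finsum_induction (· ∈ padicIntegral p) (zero_mem _) (fun _ _ => add_mem) fun d => ?_
  rw [binomialSeries_coeff, smul_eq_mul, smul_eq_mul, mul_one]
  refine mul_mem (choose_mem_padicIntegral ht d) (coeff_pow_mem (fun m => ?_) d n)
  rw [map_sub, coeff_one]
  refine sub_mem (coeff_eulerProduct_mem _ m) ?_
  split_ifs
  · exact one_mem _
  · exact zero_mem _

theorem eulerPow_natCast_add (d : ℕ) (t : ℚ) :
    eulerPow (d + t) = eulerProduct ^ d * eulerPow t := by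
  have h := hasSubst_eulerProduct_sub_one
  rw [eulerPow, binomialSeries_add, subst_mul h, binomialSeries_nat, subst_pow h, subst_add h,
    subst_X h, ← map_one C, subst_C]
  congr 2
  change C 1 + (eulerProduct - 1) = _
  rw [map_one, add_sub_cancel]

theorem derivative_binomialSeries (t : ℚ) :
    derivative ℚ (PowerSeries.binomialSeries ℚ t) = t • PowerSeries.binomialSeries ℚ (t - 1) := by
  ext n
  have h := Ring.choose_smul_choose t (show 1 ≤ n + 1 by omega)
  simp only [Nat.choose_one_right, nsmul_eq_mul, Ring.choose_one_right, Nat.add_sub_cancel,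
    Nat.cast_add, Nat.cast_one] at h
  simp [coeff_derivative, ← h, mul_comm]

theorem derivative_eulerPow (t : ℚ) :
    derivative ℚ (eulerPow t) = t • (eulerPow (t - 1) * derivative ℚ eulerProduct) := by
  have h := hasSubst_eulerProduct_sub_one
  rw [eulerPow, derivative_subst h, derivative_binomialSeries, subst_smul h, map_sub,
    ← map_one C, derivative_C, sub_zero, smul_mul_assoc, map_one, eulerPow]

/-- Compare coefficients in (E₁^t)' = t E₁^(t-1) E₁': the cofactor of `t` is `p`-integral. -/
theorem padicNorm_natCast_mul_coeff_eulerPow_le {t : ℚ} (ht : t ∈ padicIntegral p) (n : ℕ) :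
    padicNorm p (n * coeff n (eulerPow t)) ≤ padicNorm p t := by
  cases n with
  | zero => simpa using padicNorm.nonneg t
  | succ n =>
    have h := congrArg (coeff n) (derivative_eulerPow t)
    rw [coeff_derivative, mul_comm, map_smul, smul_eq_mul] at h
    push_cast
    rw [h, padicNorm.mul]
    refine mul_le_of_le_one_right (padicNorm.nonneg t) (mem_padicIntegral.mp ?_)
    refine coeff_mul_mem (coeff_eulerPow_mem (sub_mem ht (one_mem _))) (fun m => ?_) n
    rw [coeff_derivative]
    exact mul_mem (coeff_eulerProduct_mem _ _) (add_mem (natCast_mem _ m) (one_mem _))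

/-- If `a n` vanishes when `v_p (u n + w)` is odd and is divisible by the `p`-part of `u n + w`, then
multiplication by a series `c` with `n * c n` divisible by `p ^ k` gives coefficients divisible
by `p ^ k` at the indices where `v_p (u n + w)` is odd. -/
theorem padicNorm_coeff_mul_le {a c : PowerSeries ℚ} {u w : ℕ} {ε : ℚ} (hu : ¬ p ∣ u)
    (hw : w ≠ 0) (hodd : ∀ n, Odd (padicValNat p (u * n + w)) → coeff n a = 0)
    (hle : ∀ n, padicNorm p (coeff n a) ≤ padicNorm p (u * n + w : ℕ))
    (hc : ∀ n : ℕ, padicNorm p (n * coeff n c) ≤ ε) {N : ℕ}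
    (hN : Odd (padicValNat p (u * N + w))) : padicNorm p (coeff N (a * c)) ≤ ε := by
  have hε : 0 ≤ ε := (padicNorm.nonneg _).trans (hc 0)
  rw [coeff_mul]
  refine padicNorm.sum_le' (fun x hx => ?_) hε
  obtain ⟨i, j⟩ := x
  obtain rfl := Finset.HasAntidiagonal.mem_antidiagonal.mp hx
  rcases le_or_gt (padicNorm p (u * i + w : ℕ)) (padicNorm p j) with h | h
  · refine le_trans ?_ (hc j)
    rw [padicNorm.mul, padicNorm.mul]
    exact mul_le_mul_of_nonneg_right ((hle i).trans h) (padicNorm.nonneg _)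
  -- Here `j` is strictly more divisible by `p` than ui + w (this includes j = 0), so adding uj does
  -- not change the valuation.
  · have huj : padicNorm p ((u * j : ℕ) : ℚ) = padicNorm p j := by
      rw [Nat.cast_mul, padicNorm.mul, (padicNorm.nat_eq_one_iff u).mpr hu, one_mul]
    have h1 : padicNorm p ((u * (i + j) + w : ℕ) : ℚ) = padicNorm p (u * i + w : ℕ) := by
      rw [show u * (i + j) + w = (u * i + w) + u * j by ring, Nat.cast_add,
        padicNorm.add_eq_max_of_ne (by rw [huj]; exact h.ne'), huj, max_eq_left h.le]
    have hp : (1 : ℚ) < p := by exact_mod_cast (Fact.out : p.Prime).one_lt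
    rw [padicNorm.eq_zpow_of_nonzero (by positivity), padicNorm.eq_zpow_of_nonzero (by positivity),
      padicValRat.of_nat, padicValRat.of_nat] at h1
    have h2 := zpow_right_injective₀ (by linarith) hp.ne' h1
    have h3 : padicValNat p (u * (i + j) + w) = padicValNat p (u * i + w) := by
      exact_mod_cast neg_injective h2
    rw [hodd i (h3 ▸ hN), zero_mul, padicNorm.zero]
    exact hε

theorem congrZero_of_padicNorm_le {x : ℚ} {k : ℕ} (h : padicNorm p x ≤ (p : ℚ) ^ (-k : ℤ)) :
    CongrZero x (p ^ k) := by
  rw [CongrZero, padicNorm.dvd_iff_norm_le]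
  refine le_trans ?_ h
  conv_lhs => rw [← Rat.mul_den_eq_num, padicNorm.mul]
  exact mul_le_of_le_one_right (padicNorm.nonneg _) (padicNorm.of_nat _)

theorem congrZero_fracPartition {d u w k : ℕ} {b : ℤ} (hb : ¬ (p : ℤ) ∣ b) (hu : ¬ p ∣ u)
    (hw : w ≠ 0)
    (hodd : ∀ n, Odd (padicValNat p (u * n + w)) → coeff n (eulerProduct ^ d) = 0)
    (hle : ∀ n, padicNorm p (coeff n (eulerProduct ^ d)) ≤ padicNorm p (u * n + w : ℕ)) {N : ℕ}
    (hN : Odd (padicValNat p (u * N + w))) :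
    CongrZero (fracPartition (-(((p : ℚ) ^ k - d * (b : ℚ)) / (b : ℚ))) N) (p ^ k) := by
  have hb0 : (b : ℚ) ≠ 0 := by
    rintro h
    exact hb (by simp [Int.cast_eq_zero.mp h])
  have ht : padicNorm p (-((p : ℚ) ^ k / b)) = (p : ℚ) ^ (-k : ℤ) := by
    rw [padicNorm.neg, padicNorm.div, (padicNorm.int_eq_one_iff b).mpr hb, div_one,
      ← Nat.cast_pow, padicNorm.eq_zpow_of_nonzero
        (by exact_mod_cast (pow_ne_zero _ (Fact.out : p.Prime).ne_zero)), padicValRat.of_nat]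
    simp
  have ht' : -((p : ℚ) ^ k / b) ∈ padicIntegral p := by
    rw [mem_padicIntegral, ht, zpow_neg, zpow_natCast]
    exact inv_le_one_of_one_le₀ (one_le_pow₀ (by exact_mod_cast (Fact.out : p.Prime).one_le))
  apply congrZero_of_padicNorm_le
  -- An integral power with known coefficients times a power whose exponent is divisible by `p^k`.
  have : -(((p : ℚ) ^ k - d * (b : ℚ)) / (b : ℚ)) = d + -((p : ℚ) ^ k / b) := by
    field_simp
    ring
  rw [fracPartition, this, eulerPow_natCast_add]
  exact padicNorm_coeff_mul_le hu hw hodd hle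
    (fun n => (padicNorm_natCast_mul_coeff_eulerPow_le ht' n).trans ht.le) hN

end Integrality

/-! ### The sixth power at primes p ≡ 3 mod 4, via sums of two squares -/

section SixthPower

theorem dvd_and_dvd_of_dvd_sq_add_sq {p : ℕ} (hp : p.Prime) (h3 : p % 4 = 3) {x y : ℕ}
    (h : p ∣ x ^ 2 + y ^ 2) : p ∣ x ∧ p ∣ y := by
  have : Fact p.Prime := ⟨hp⟩
  have key {x y : ℕ} (h : p ∣ x ^ 2 + y ^ 2) : p ∣ y := by
    by_contra hy
    have hy' : (y : ZMod p) ≠ 0 := fun h => hy ((ZMod.natCast_eq_zero_iff _ _).mp h)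
    have h' : (x : ZMod p) ^ 2 = -(y : ZMod p) ^ 2 := by
      rw [eq_neg_iff_add_eq_zero]
      exact_mod_cast (ZMod.natCast_eq_zero_iff _ _).mpr h
    exact ZMod.mod_four_ne_three_of_sq_eq_neg_sq' hy' h' h3
  exact ⟨key (add_comm (x ^ 2) _ ▸ h), key h⟩

/-- Descent: since -1 is not a square mod `p`, a factor `p` of the sum divides both `x` and `y`, and
dividing it out removes p^2 both from the sum and from xy. -/
theorem even_padicValNat_sq_add_sq {p : ℕ} (hp : p.Prime) (h3 : p % 4 = 3) (x y : ℕ)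
    (hx : x ≠ 0) : Even (padicValNat p (x ^ 2 + y ^ 2)) ∧
      p ^ padicValNat p (x ^ 2 + y ^ 2) ∣ x * y := by
  have : Fact p.Prime := ⟨hp⟩
  induction x using Nat.strong_induction_on generalizing y with
  | _ x ih =>
    by_cases h : p ∣ x ^ 2 + y ^ 2
    · obtain ⟨⟨a, rfl⟩, ⟨b, rfl⟩⟩ := dvd_and_dvd_of_dvd_sq_add_sq hp h3 h
      have ha : a ≠ 0 := right_ne_zero_of_mul hx
      obtain ⟨h1, h2⟩ := ih a (by nlinarith [hp.two_le, Nat.pos_of_ne_zero ha]) b ha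
      have e : padicValNat p ((p * a) ^ 2 + (p * b) ^ 2) = 2 + padicValNat p (a ^ 2 + b ^ 2) := by
        rw [show (p * a) ^ 2 + (p * b) ^ 2 = p ^ 2 * (a ^ 2 + b ^ 2) by ring,
          padicValNat.mul (pow_ne_zero _ hp.ne_zero) (by positivity), padicValNat.prime_pow]
      rw [e, pow_add, show p * a * (p * b) = p ^ 2 * (a * b) by ring]
      exact ⟨even_two.add h1, mul_dvd_mul_left _ h2⟩
    · rw [padicValNat.eq_zero_of_not_dvd h]
      simp

theorem padicNorm_natCast {p n : ℕ} (hn : n ≠ 0) :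
    padicNorm p n = (p : ℚ) ^ (-(padicValNat p n : ℤ)) := by
  rw [padicNorm.eq_zpow_of_nonzero (by exact_mod_cast hn), padicValRat.of_nat]

theorem padicNorm_le_of_dvd {p n : ℕ} [Fact p.Prime] (hn : n ≠ 0) {z : ℤ}
    (h : (p : ℤ) ^ padicValNat p n ∣ z) : padicNorm p z ≤ padicNorm p n := by
  rw [padicNorm_natCast hn]
  exact padicNorm.dvd_iff_norm_le.mp (by exact_mod_cast h)

variable {p : ℕ} [hp : Fact p.Prime]

/-- Completing squares gives (2i+1)^2 + (2j+1)^2 = 2(4n + 1), and `p` is odd. The weights 2i+1 and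
2j+1 in E₁^6 are the very numbers being squared. -/
theorem padicValNat_of_choose_two_add_choose_two (h3 : p % 4 = 3) {i j n : ℕ}
    (h : (i + 1).choose 2 + (j + 1).choose 2 = n) :
    padicValNat p (4 * n + 1) = padicValNat p ((2 * i + 1) ^ 2 + (2 * j + 1) ^ 2) := by
  have e : (2 * i + 1) ^ 2 + (2 * j + 1) ^ 2 = 2 * (4 * n + 1) := by
    rw [← h, ← Nat.cast_inj (R := ℚ)]
    push_cast [Nat.cast_choose_two]
    ring
  rw [e, padicValNat.mul two_ne_zero (by omega), padicValNat.eq_zero_of_not_dvd (n := 2), zero_add]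
  intro h2
  have := (Nat.prime_dvd_prime_iff_eq hp.out Nat.prime_two).mp h2
  omega

theorem coeff_eulerProduct_pow_six_eq_zero (h3 : p % 4 = 3) (n : ℕ)
    (hn : Odd (padicValNat p (4 * n + 1))) : PowerSeries.coeff n (eulerProduct ^ 6) = 0 := by
  rw [coeff_eulerProduct_pow_six]
  refine Finset.sum_eq_zero fun i _ => Finset.sum_eq_zero fun j _ => if_neg fun h => ?_
  rw [padicValNat_of_choose_two_add_choose_two h3 h, ← Nat.not_even_iff_odd] at hn
  exact hn (even_padicValNat_sq_add_sq hp.out h3 _ _ (by omega)).1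

theorem padicNorm_coeff_eulerProduct_pow_six_le (h3 : p % 4 = 3) (n : ℕ) :
    padicNorm p (PowerSeries.coeff n (eulerProduct ^ 6)) ≤ padicNorm p (4 * n + 1 : ℕ) := by
  rw [coeff_eulerProduct_pow_six]
  refine padicNorm.sum_le' (fun i _ => padicNorm.sum_le' (fun j _ => ?_) (padicNorm.nonneg _))
    (padicNorm.nonneg _)
  split_ifs with h
  · have h1 := (even_padicValNat_sq_add_sq hp.out h3 (2 * i + 1) (2 * j + 1) (by omega)).2
    rw [← padicValNat_of_choose_two_add_choose_two h3 h] at h1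
    have h2 := padicNorm_le_of_dvd (p := p) (n := 4 * n + 1) (by omega)
      ((show (p : ℤ) ^ padicValNat p (4 * n + 1) ∣ ((2 * i + 1) * (2 * j + 1) : ℕ) by
        exact_mod_cast h1).mul_left ((-1) ^ (i + j)))
    exact_mod_cast h2
  · rw [padicNorm.zero]
    exact padicNorm.nonneg _

end SixthPower

/-! ### The 5-dissection of E₁ and recursions for E₁^8 and E₁^14 -/

section FiveDissection

open PowerSeries

theorem coeff_X_pow_mul_expand_five (f : PowerSeries ℚ) (n : ℕ) {r s : ℕ} (hr : r < 5)
    (hs : s < 5) :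
    coeff (5 * n + r) (X ^ s * expand 5 (NeZero.ne 5) f) = if r = s then coeff n f else 0 := by
  rw [coeff_X_pow_mul']
  split_ifs with h1 h2 h2
  · rw [h2, Nat.add_sub_cancel, coeff_expand_mul]
  · exact coeff_expand_of_not_dvd _ _ _ (by omega)
  · omega
  · rfl

theorem coeff_sum_X_pow_mul_expand (P : Fin 5 → PowerSeries ℚ) (n : ℕ) (r : Fin 5) :
    coeff (5 * n + r) (∑ s : Fin 5, X ^ (s : ℕ) * expand 5 (NeZero.ne 5) (P s)) =
      coeff n (P r) := by
  rw [map_sum]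
  simp only [coeff_X_pow_mul_expand_five _ _ (Fin.is_lt _) (Fin.is_lt _), Fin.val_inj]
  simp

/-- The series `∑ a (5 n + r) q ^ n` attached to `∑ a n q ^ n`. -/
noncomputable def fiveSection (f : PowerSeries ℚ) (r : ℕ) : PowerSeries ℚ :=
  PowerSeries.mk fun n => coeff (5 * n + r) f

theorem eq_of_coeff_eq_zero {f : PowerSeries ℚ}
    (hf : ∀ n, n % 5 = 3 ∨ n % 5 = 4 → coeff n f = 0) :
    f = expand 5 (NeZero.ne 5) (fiveSection f 0) + X * expand 5 (NeZero.ne 5) (fiveSection f 1) +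
      X ^ 2 * expand 5 (NeZero.ne 5) (fiveSection f 2) := by
  have e : expand 5 (NeZero.ne 5) (fiveSection f 0) + X * expand 5 (NeZero.ne 5) (fiveSection f 1) +
      X ^ 2 * expand 5 (NeZero.ne 5) (fiveSection f 2) = ∑ s : Fin 5, X ^ (s : ℕ) *
        expand 5 (NeZero.ne 5) (![fiveSection f 0, fiveSection f 1, fiveSection f 2, 0, 0] s) := by
    simp [Fin.sum_univ_five]
  rw [e]
  ext n
  obtain ⟨m, r, rfl⟩ : ∃ (m : ℕ) (r : Fin 5), 5 * m + (r : ℕ) = n :=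
    ⟨n / 5, ⟨n % 5, Nat.mod_lt _ (by norm_num)⟩, Nat.div_add_mod n 5⟩
  rw [coeff_sum_X_pow_mul_expand]
  fin_cases r
  · simp [fiveSection]
  · simp [fiveSection]
  · simp [fiveSection]
  · simpa using hf _ (by simp)
  · simpa using hf _ (by simp)

theorem pentagonal_mod_five (k : ℤ) :
    pentagonal k % 5 = 0 ∨ pentagonal k % 5 = 2 ∨ (pentagonal k % 5 = 1 ∧ k % 5 = 1) := by
  have h := two_mul_natCast_pentagonal k
  generalize pentagonal k = m at h
  have hk := Int.mul_ediv_add_emod k 5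
  have h0 := Int.emod_nonneg k (show (5 : ℤ) ≠ 0 by norm_num)
  have h1 := Int.emod_lt_of_pos k (show (0 : ℤ) < 5 by norm_num)
  generalize k / 5 = l at hk
  generalize k % 5 = r at hk h0 h1 ⊢
  subst hk
  have h2 : (2 * m : ℤ) = 5 * (l * (15 * l + 6 * r - 1)) + r * (3 * r - 1) := by linarith
  generalize l * (15 * l + 6 * r - 1) = t at h2
  interval_cases r <;> omega

theorem pentagonal_one_sub_five_mul (l : ℤ) : pentagonal (1 - 5 * l) = 25 * pentagonal l + 1 := by
  have h1 := two_mul_natCast_pentagonal (1 - 5 * l)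
  have h2 := two_mul_natCast_pentagonal l
  have : (2 * pentagonal (1 - 5 * l) : ℤ) = 2 * (25 * pentagonal l + 1) := by linarith
  omega

theorem coeff_eulerProduct_eq_zero (n : ℕ) (h : n % 5 = 3 ∨ n % 5 = 4) :
    coeff n eulerProduct = 0 := by
  rw [eulerProduct_eq_pentagonalSeries]
  refine coeff_pentagonalSeries_eq_zero ℚ ?_
  rintro ⟨k, rfl⟩
  have := pentagonal_mod_five k
  omega

theorem pentagonal_eq_five_mul_add_one {k : ℤ} {n : ℕ} (h : pentagonal k = 5 * n + 1) :
    ∃ l, k = 1 - 5 * l ∧ n = 5 * pentagonal l := by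
  have hk : k = 1 - 5 * (-(k / 5)) := by
    have := pentagonal_mod_five k
    omega
  refine ⟨_, hk, ?_⟩
  have := pentagonal_one_sub_five_mul (-(k / 5))
  rw [← hk] at this
  omega

/-- Pentagonal numbers ≡ 1 mod 5 come exactly from k = 1 - 5l, where they equal 25 `pentagonal l` +
1 and the sign (-1)^k is -(-1)^l. -/
theorem fiveSection_eulerProduct_one :
    fiveSection eulerProduct 1 = -expand 5 (NeZero.ne 5) eulerProduct := by
  ext n
  rw [fiveSection, coeff_mk, map_neg, coeff_expand, eulerProduct_eq_pentagonalSeries]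
  by_cases hn : 5 * n + 1 ∈ Set.range pentagonal
  · obtain ⟨k, hk⟩ := hn
    obtain ⟨l, rfl, rfl⟩ := pentagonal_eq_five_mul_add_one hk
    rw [if_pos (dvd_mul_right _ _), Nat.mul_div_cancel_left _ (by norm_num), ← hk,
      coeff_pentagonalSeries_pentagonal, coeff_pentagonalSeries_pentagonal, Int.negOnePow_sub,
      show (5 * l).negOnePow = l.negOnePow from (Int.negOnePow_eq_iff _ _).mpr ⟨2 * l, by ring⟩]
    simp
  · rw [coeff_pentagonalSeries_eq_zero ℚ hn, eq_comm, neg_eq_zero]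
    split_ifs with h5
    · obtain ⟨m, rfl⟩ := h5
      rw [Nat.mul_div_cancel_left _ (by norm_num)]
      refine coeff_pentagonalSeries_eq_zero ℚ ?_
      rintro ⟨l, rfl⟩
      exact hn ⟨1 - 5 * l, by rw [pentagonal_one_sub_five_mul]; ring⟩
    · rfl

/-- By Jacobi the exponents in E₁^3 are triangular numbers, never 2 mod 5. -/
theorem coeff_eulerProduct_pow_three_eq_zero (n : ℕ) :
    coeff (5 * n + 2) (eulerProduct ^ 3) = 0 := by
  rw [coeff_eulerProduct_pow_three le_rfl, map_sum]
  refine Finset.sum_eq_zero fun j _ => ?_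
  rw [coeff_C_mul, coeff_X_pow, if_neg, mul_zero]
  intro h
  have h2 : 2 * (j + 1).choose 2 = j * (j + 1) := by
    rw [← Nat.cast_inj (R := ℚ)]
    push_cast [Nat.cast_choose_two]
    ring
  rw [← h] at h2
  have h3 := congrArg (· % 5) h2
  simp only [Nat.mul_mod j] at h3
  have h4 := Nat.mod_lt j (show 0 < 5 by norm_num)
  rw [Nat.add_mod j 1] at h3
  interval_cases j % 5 <;> omega

/-- Write a, b, c for the sections of E₁. The part of E₁^3 with exponents 2 mod 5 is 3a(ac + b^2);
it vanishes, and a ≠ 0. -/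
theorem fiveSection_eulerProduct_mul :
    fiveSection eulerProduct 0 * fiveSection eulerProduct 2 + fiveSection eulerProduct 1 ^ 2 =
      0 := by
  have ha : fiveSection eulerProduct 0 ≠ 0 := by
    intro h
    have := congrArg (coeff 0) h
    rw [fiveSection, coeff_mk, map_zero, mul_zero, add_zero, coeff_zero_eq_constantCoeff_apply,
      constantCoeff_eulerProduct] at this
    exact one_ne_zero this
  have hE := eq_of_coeff_eq_zero coeff_eulerProduct_eq_zero
  have h0 := coeff_eulerProduct_pow_three_eq_zero
  rw [hE] at h0
  generalize fiveSection eulerProduct 0 = a at *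
  generalize fiveSection eulerProduct 1 = b at *
  generalize fiveSection eulerProduct 2 = c at *
  let P : Fin 5 → PowerSeries ℚ := ![a ^ 3 + 3 * (X * b * c ^ 2),
    3 * (a ^ 2 * b) + X * c ^ 3, 3 * (a * (a * c + b ^ 2)), b ^ 3 + 6 * (a * b * c),
    3 * (b ^ 2 * c) + 3 * (a * c ^ 2)]
  have e : (expand 5 (NeZero.ne 5) a + X * expand 5 (NeZero.ne 5) b +
      X ^ 2 * expand 5 (NeZero.ne 5) c) ^ 3 = ∑ s : Fin 5, X ^ (s : ℕ) *
        expand 5 (NeZero.ne 5) (P s) := by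
    simp only [P, Fin.sum_univ_five, map_add, map_mul, map_pow,
      map_ofNat, expand_X, Matrix.cons_val, Fin.coe_ofNat_eq_mod]
    ring
  have h3 : 3 * (a * (a * c + b ^ 2)) = 0 := by
    ext n
    rw [map_zero, ← h0 n, e]
    exact (coeff_sum_X_pow_mul_expand P n 2).symm
  have hthree : (3 : PowerSeries ℚ) ≠ 0 := fun h => by
    simpa [map_ofNat] using congrArg (constantCoeff (R := ℚ)) h
  exact (mul_eq_zero.mp ((mul_eq_zero.mp h3).resolve_left hthree)).resolve_left ha

/-- In this residue class the exponents of `a` and `c` are congruent mod 5. Modulo ac = -b^2, the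
terms with unequal exponents cancel, and the terms (ac)^i b^(8-2i) sum to (1 - 56 + 420 - 560 + 70)
b^8 = -125 b^8. -/
theorem coeff_trinomial_pow_eight {a b c : PowerSeries ℚ} (h : a * c + b ^ 2 = 0) (n : ℕ) :
    coeff (5 * n + 3) ((expand 5 (NeZero.ne 5) a + X * expand 5 (NeZero.ne 5) b +
      X ^ 2 * expand 5 (NeZero.ne 5) c) ^ 8) = coeff n (-125 * (X * b ^ 8)) := by
  let P0 : PowerSeries ℚ :=
    a ^ 8 + 56 * a ^ 3 * b ^ 5 * X + 280 * a ^ 4 * b ^ 3 * c * X + 168 * a ^ 5 * b * c ^ 2 * X +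
    28 * b ^ 6 * c ^ 2 * X ^ 2 + 280 * a * b ^ 4 * c ^ 3 * X ^ 2 + 420 * a ^ 2 * b ^ 2 * c ^ 4 * X
    ^ 2 + 56 * a ^ 3 * c ^ 5 * X ^ 2 + 8 * b * c ^ 7 * X ^ 3
  let P1 : PowerSeries ℚ :=
    8 * a ^ 7 * b + 28 * a ^ 2 * b ^ 6 * X + 280 * a ^ 3 * b ^ 4 * c * X + 420 * a ^ 4 * b ^ 2 * c
    ^ 2 * X + 56 * a ^ 5 * c ^ 3 * X + 56 * b ^ 5 * c ^ 3 * X ^ 2 + 280 * a * b ^ 3 * c ^ 4 * X ^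
    2 + 168 * a ^ 2 * b * c ^ 5 * X ^ 2 + c ^ 8 * X ^ 3
  let P2 : PowerSeries ℚ :=
    28 * a ^ 6 * b ^ 2 + 8 * a * b ^ 7 * X + 8 * a ^ 7 * c + 168 * a ^ 2 * b ^ 5 * c * X + 560 * a
    ^ 3 * b ^ 3 * c ^ 2 * X + 280 * a ^ 4 * b * c ^ 3 * X + 70 * b ^ 4 * c ^ 4 * X ^ 2 + 168 * a *
    b ^ 2 * c ^ 5 * X ^ 2 + 28 * a ^ 2 * c ^ 6 * X ^ 2
  let P4 : PowerSeries ℚ :=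
    70 * a ^ 4 * b ^ 4 + 168 * a ^ 5 * b ^ 2 * c + 8 * b ^ 7 * c * X + 28 * a ^ 6 * c ^ 2 + 168 *
    a * b ^ 5 * c ^ 2 * X + 560 * a ^ 2 * b ^ 3 * c ^ 3 * X + 280 * a ^ 3 * b * c ^ 4 * X + 28 * b
    ^ 2 * c ^ 6 * X ^ 2 + 8 * a * c ^ 7 * X ^ 2
  let P3 : PowerSeries ℚ := -125 * (X * b ^ 8)
  have e : (expand 5 (NeZero.ne 5) a + X * expand 5 (NeZero.ne 5) b +
      X ^ 2 * expand 5 (NeZero.ne 5) c) ^ 8 = ∑ s : Fin 5, X ^ (s : ℕ) *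
        expand 5 (NeZero.ne 5) (![P0, P1, P2, P3, P4] s) := by
    have h' := congrArg (expand 5 (NeZero.ne 5)) h
    simp only [map_add, map_mul, map_pow, map_zero] at h'
    simp only [P0, P1, P2, P3, P4, Fin.sum_univ_five, map_add, map_mul, map_pow, map_neg,
      map_ofNat, expand_X, Matrix.cons_val, Fin.coe_ofNat_eq_mod]
    generalize expand 5 (NeZero.ne 5) a = a at h' ⊢
    generalize expand 5 (NeZero.ne 5) b = b at h' ⊢
    generalize expand 5 (NeZero.ne 5) c = c at h' ⊢
    -- `P0`, `P1`, `P2`, `P4` are unreduced parts of the multinomial expansion; only `P3` was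
    -- reduced, and the cofactor is its quotient by ac + b^2.
    linear_combination X ^ 3 * (56 * a ^ 5 * b + 126 * b ^ 6 * X ^ 5 + (-70) * a * b ^ 4 * c * X ^ 5 + 490 * a ^ 2 * b ^ 2 *
      c ^ 2 * X ^ 5 + 70 * a ^ 3 * c ^ 3 * X ^ 5 + 56 * b * c ^ 5 * X ^ 10) * h'
  rw [e]
  exact coeff_sum_X_pow_mul_expand ![P0, P1, P2, P3, P4] n 3

set_option maxHeartbeats 2000000 in
-- The same cancellation; the alternating sum of 14!/(i!^2 (14-2i)!) is -15625 = -5^6.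
theorem coeff_trinomial_pow_fourteen {a b c : PowerSeries ℚ} (h : a * c + b ^ 2 = 0) (n : ℕ) :
    coeff (5 * n + 4) ((expand 5 (NeZero.ne 5) a + X * expand 5 (NeZero.ne 5) b +
      X ^ 2 * expand 5 (NeZero.ne 5) c) ^ 14) = coeff n (-15625 * (X ^ 2 * b ^ 14)) := by
  let P0 : PowerSeries ℚ :=
    a ^ 14 + 2002 * a ^ 9 * b ^ 5 * X + 1001 * a ^ 4 * b ^ 10 * X ^ 2 + 4004 * a ^ 10 * b ^ 3 * c
    * X + 18018 * a ^ 5 * b ^ 8 * c * X ^ 2 + 14 * b ^ 13 * c * X ^ 3 + 1092 * a ^ 11 * b * c ^ 2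
    * X + 84084 * a ^ 6 * b ^ 6 * c ^ 2 * X ^ 2 + 1092 * a * b ^ 11 * c ^ 2 * X ^ 3 + 120120 * a ^
    7 * b ^ 4 * c ^ 3 * X ^ 2 + 20020 * a ^ 2 * b ^ 9 * c ^ 3 * X ^ 3 + 45045 * a ^ 8 * b ^ 2 * c
    ^ 4 * X ^ 2 + 120120 * a ^ 3 * b ^ 7 * c ^ 4 * X ^ 3 + 2002 * a ^ 9 * c ^ 5 * X ^ 2 + 252252 *
    a ^ 4 * b ^ 5 * c ^ 5 * X ^ 3 + 168168 * a ^ 5 * b ^ 3 * c ^ 6 * X ^ 3 + 3003 * b ^ 8 * c ^ 6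
    * X ^ 4 + 24024 * a ^ 6 * b * c ^ 7 * X ^ 3 + 24024 * a * b ^ 6 * c ^ 7 * X ^ 4 + 45045 * a ^
    2 * b ^ 4 * c ^ 8 * X ^ 4 + 20020 * a ^ 3 * b ^ 2 * c ^ 9 * X ^ 4 + 1001 * a ^ 4 * c ^ 10 * X
    ^ 4 + 364 * b ^ 3 * c ^ 11 * X ^ 5 + 182 * a * b * c ^ 12 * X ^ 5
  let P1 : PowerSeries ℚ :=
    14 * a ^ 13 * b + 3003 * a ^ 8 * b ^ 6 * X + 364 * a ^ 3 * b ^ 11 * X ^ 2 + 10010 * a ^ 9 * b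
    ^ 4 * c * X + 10010 * a ^ 4 * b ^ 9 * c * X ^ 2 + 6006 * a ^ 10 * b ^ 2 * c ^ 2 * X + 72072 *
    a ^ 5 * b ^ 7 * c ^ 2 * X ^ 2 + 91 * b ^ 12 * c ^ 2 * X ^ 3 + 364 * a ^ 11 * c ^ 3 * X +
    168168 * a ^ 6 * b ^ 5 * c ^ 3 * X ^ 2 + 4004 * a * b ^ 10 * c ^ 3 * X ^ 3 + 120120 * a ^ 7 *
    b ^ 3 * c ^ 4 * X ^ 2 + 45045 * a ^ 2 * b ^ 8 * c ^ 4 * X ^ 3 + 18018 * a ^ 8 * b * c ^ 5 * X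
    ^ 2 + 168168 * a ^ 3 * b ^ 6 * c ^ 5 * X ^ 3 + 210210 * a ^ 4 * b ^ 4 * c ^ 6 * X ^ 3 + 72072
    * a ^ 5 * b ^ 2 * c ^ 7 * X ^ 3 + 3432 * b ^ 7 * c ^ 7 * X ^ 4 + 3003 * a ^ 6 * c ^ 8 * X ^ 3
    + 18018 * a * b ^ 5 * c ^ 8 * X ^ 4 + 20020 * a ^ 2 * b ^ 3 * c ^ 9 * X ^ 4 + 4004 * a ^ 3 * b
    * c ^ 10 * X ^ 4 + 91 * b ^ 2 * c ^ 12 * X ^ 5 + 14 * a * c ^ 13 * X ^ 5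
  let P2 : PowerSeries ℚ :=
    91 * a ^ 12 * b ^ 2 + 3432 * a ^ 7 * b ^ 7 * X + 91 * a ^ 2 * b ^ 12 * X ^ 2 + 14 * a ^ 13 * c
    + 18018 * a ^ 8 * b ^ 5 * c * X + 4004 * a ^ 3 * b ^ 10 * c * X ^ 2 + 20020 * a ^ 9 * b ^ 3 *
    c ^ 2 * X + 45045 * a ^ 4 * b ^ 8 * c ^ 2 * X ^ 2 + 4004 * a ^ 10 * b * c ^ 3 * X + 168168 * a
    ^ 5 * b ^ 6 * c ^ 3 * X ^ 2 + 364 * b ^ 11 * c ^ 3 * X ^ 3 + 210210 * a ^ 6 * b ^ 4 * c ^ 4 *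
    X ^ 2 + 10010 * a * b ^ 9 * c ^ 4 * X ^ 3 + 72072 * a ^ 7 * b ^ 2 * c ^ 5 * X ^ 2 + 72072 * a
    ^ 2 * b ^ 7 * c ^ 5 * X ^ 3 + 3003 * a ^ 8 * c ^ 6 * X ^ 2 + 168168 * a ^ 3 * b ^ 5 * c ^ 6 *
    X ^ 3 + 120120 * a ^ 4 * b ^ 3 * c ^ 7 * X ^ 3 + 18018 * a ^ 5 * b * c ^ 8 * X ^ 3 + 3003 * b
    ^ 6 * c ^ 8 * X ^ 4 + 10010 * a * b ^ 4 * c ^ 9 * X ^ 4 + 6006 * a ^ 2 * b ^ 2 * c ^ 10 * X ^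
    4 + 364 * a ^ 3 * c ^ 11 * X ^ 4 + 14 * b * c ^ 13 * X ^ 5
  let P3 : PowerSeries ℚ :=
    364 * a ^ 11 * b ^ 3 + 3003 * a ^ 6 * b ^ 8 * X + 14 * a * b ^ 13 * X ^ 2 + 182 * a ^ 12 * b *
    c + 24024 * a ^ 7 * b ^ 6 * c * X + 1092 * a ^ 2 * b ^ 11 * c * X ^ 2 + 45045 * a ^ 8 * b ^ 4
    * c ^ 2 * X + 20020 * a ^ 3 * b ^ 9 * c ^ 2 * X ^ 2 + 20020 * a ^ 9 * b ^ 2 * c ^ 3 * X +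
    120120 * a ^ 4 * b ^ 7 * c ^ 3 * X ^ 2 + 1001 * a ^ 10 * c ^ 4 * X + 252252 * a ^ 5 * b ^ 5 *
    c ^ 4 * X ^ 2 + 1001 * b ^ 10 * c ^ 4 * X ^ 3 + 168168 * a ^ 6 * b ^ 3 * c ^ 5 * X ^ 2 + 18018
    * a * b ^ 8 * c ^ 5 * X ^ 3 + 24024 * a ^ 7 * b * c ^ 6 * X ^ 2 + 84084 * a ^ 2 * b ^ 6 * c ^
    6 * X ^ 3 + 120120 * a ^ 3 * b ^ 4 * c ^ 7 * X ^ 3 + 45045 * a ^ 4 * b ^ 2 * c ^ 8 * X ^ 3 +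
    2002 * a ^ 5 * c ^ 9 * X ^ 3 + 2002 * b ^ 5 * c ^ 9 * X ^ 4 + 4004 * a * b ^ 3 * c ^ 10 * X ^
    4 + 1092 * a ^ 2 * b * c ^ 11 * X ^ 4 + c ^ 14 * X ^ 5
  let P4 : PowerSeries ℚ := -15625 * (X ^ 2 * b ^ 14)
  have e : (expand 5 (NeZero.ne 5) a + X * expand 5 (NeZero.ne 5) b +
      X ^ 2 * expand 5 (NeZero.ne 5) c) ^ 14 = ∑ s : Fin 5, X ^ (s : ℕ) *
        expand 5 (NeZero.ne 5) (![P0, P1, P2, P3, P4] s) := by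
    have h' := congrArg (expand 5 (NeZero.ne 5)) h
    simp only [map_add, map_mul, map_pow, map_zero] at h'
    simp only [P0, P1, P2, P3, P4, Fin.sum_univ_five, map_add, map_mul, map_pow, map_neg,
      map_ofNat, expand_X, Matrix.cons_val, Fin.coe_ofNat_eq_mod]
    generalize expand 5 (NeZero.ne 5) a = a at h' ⊢
    generalize expand 5 (NeZero.ne 5) b = b at h' ⊢
    generalize expand 5 (NeZero.ne 5) c = c at h' ⊢
    linear_combination X ^ 4 * (1001 * a ^ 10 * b ^ 2 + 2002 * a ^ 5 * b ^ 7 * X ^ 5 + 15626 * b ^ 12 * X ^ 10 + 91 * a ^ 11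
      * c + 22022 * a ^ 6 * b ^ 5 * c * X ^ 5 + (-15444) * a * b ^ 10 * c * X ^ 10 + 50050 * a ^ 7
      * b ^ 3 * c ^ 2 * X ^ 5 + 21450 * a ^ 2 * b ^ 8 * c ^ 2 * X ^ 10 + 10010 * a ^ 8 * b * c ^ 3
      * X ^ 5 + 38610 * a ^ 3 * b ^ 6 * c ^ 3 * X ^ 10 + 171600 * a ^ 4 * b ^ 4 * c ^ 4 * X ^ 10 +
      80652 * a ^ 5 * b ^ 2 * c ^ 5 * X ^ 10 + 2002 * b ^ 7 * c ^ 5 * X ^ 15 + 3432 * a ^ 6 * c ^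
      6 * X ^ 10 + 22022 * a * b ^ 5 * c ^ 6 * X ^ 15 + 50050 * a ^ 2 * b ^ 3 * c ^ 7 * X ^ 15 +
      10010 * a ^ 3 * b * c ^ 8 * X ^ 15 + 1001 * b ^ 2 * c ^ 10 * X ^ 20 + 91 * a * c ^ 11 * X ^
      20) * h'
  rw [e]
  exact coeff_sum_X_pow_mul_expand ![P0, P1, P2, P3, P4] n 4

theorem coeff_eulerProduct_pow_eight (n : ℕ) :
    coeff (5 * n + 3) (eulerProduct ^ 8) =
      coeff n (-125 * (X * expand 5 (NeZero.ne 5) (eulerProduct ^ 8))) := by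
  have h := coeff_trinomial_pow_eight fiveSection_eulerProduct_mul n
  rw [← eq_of_coeff_eq_zero coeff_eulerProduct_eq_zero, fiveSection_eulerProduct_one,
    Even.neg_pow (by decide), ← map_pow] at h
  exact h

theorem coeff_eulerProduct_pow_fourteen (n : ℕ) :
    coeff (5 * n + 4) (eulerProduct ^ 14) =
      coeff n (-15625 * (X ^ 2 * expand 5 (NeZero.ne 5) (eulerProduct ^ 14))) := by
  have h := coeff_trinomial_pow_fourteen fiveSection_eulerProduct_mul n
  rw [← eq_of_coeff_eq_zero coeff_eulerProduct_eq_zero, fiveSection_eulerProduct_one,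
    Even.neg_pow (by decide), ← map_pow] at h
  exact h

/-- A coefficient sequence with a Hecke-type recursion at `5` vanishes when `v_5 (u n + w)` is odd
and is divisible by the `5`-part of `u n + w`. -/
theorem vanish_and_padicNorm_le_of_recursion {f : PowerSeries ℚ} {u w : ℕ} (hw : w ≠ 0)
    [Fact (Nat.Prime 5)] (hint : ∀ n, coeff n f ∈ padicIntegral 5)
    (hrec : ∀ n, 5 ∣ u * n + w → coeff n f = 0 ∨
      ∃ l < n, u * n + w = 25 * (u * l + w) ∧ ∃ z : ℤ, coeff n f = 25 * z * coeff l f) (n : ℕ) :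
    (Odd (padicValNat 5 (u * n + w)) → coeff n f = 0) ∧
      padicNorm 5 (coeff n f) ≤ padicNorm 5 (u * n + w : ℕ) := by
  induction n using Nat.strong_induction_on with
  | _ n ih =>
    by_cases h5 : 5 ∣ u * n + w
    · obtain h0 | ⟨l, hl, e, z, hz⟩ := hrec n h5
      · rw [h0, padicNorm.zero]
        exact ⟨fun _ => rfl, padicNorm.nonneg _⟩
      · obtain ⟨h1, h2⟩ := ih l hl
        rw [e, hz]
        constructor
        · intro h
          -- The factor 25 shifts the valuation by 2, so parity descends to `l`.
          rw [padicValNat.mul (by norm_num) (by omega), show 25 = 5 ^ 2 by norm_num,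
            padicValNat.prime_pow] at h
          rw [h1 ((Nat.odd_add'.mp h).mpr even_two), mul_zero]
        · push_cast at h2 ⊢
          rw [mul_assoc, padicNorm.mul, padicNorm.mul, padicNorm.mul]
          refine mul_le_mul_of_nonneg_left ?_ (padicNorm.nonneg _)
          exact (mul_le_of_le_one_left (padicNorm.nonneg _) (padicNorm.of_int z)).trans h2
    · rw [padicValNat.eq_zero_of_not_dvd h5, (padicNorm.nat_eq_one_iff _).mpr h5]
      exact ⟨fun h => absurd h (by decide), mem_padicIntegral.mp (hint n)⟩

theorem vanish_and_padicNorm_le_pow_eight [Fact (Nat.Prime 5)] (n : ℕ) :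
    (Odd (padicValNat 5 (3 * n + 1)) → coeff n (eulerProduct ^ 8) = 0) ∧
      padicNorm 5 (coeff n (eulerProduct ^ 8)) ≤ padicNorm 5 (3 * n + 1 : ℕ) := by
  refine vanish_and_padicNorm_le_of_recursion one_ne_zero
    (coeff_pow_mem (coeff_eulerProduct_mem _) 8) (fun n hn => ?_) n
  obtain ⟨m, rfl⟩ : ∃ m, n = 5 * m + 3 := ⟨n / 5, by omega⟩
  have h125 : (-125 : PowerSeries ℚ) = C (-125) := by rw [map_neg, map_ofNat]
  rw [coeff_eulerProduct_pow_eight, h125, coeff_C_mul, ← pow_one X, coeff_X_pow_mul']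
  split_ifs with h1
  · rw [coeff_expand]
    split_ifs with h2
    · right
      -- A nonzero term needs m = 5l + 1, so n = 25l + 8; and -125 = 25 · (-5).
      refine ⟨(m - 1) / 5, by omega, by omega, -5, ?_⟩
      push_cast
      ring
    · simp
  · simp

theorem vanish_and_padicNorm_le_pow_fourteen [Fact (Nat.Prime 5)] (n : ℕ) :
    (Odd (padicValNat 5 (12 * n + 7)) → coeff n (eulerProduct ^ 14) = 0) ∧
      padicNorm 5 (coeff n (eulerProduct ^ 14)) ≤ padicNorm 5 (12 * n + 7 : ℕ) := by
  refine vanish_and_padicNorm_le_of_recursion (by norm_num)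
    (coeff_pow_mem (coeff_eulerProduct_mem _) 14) (fun n hn => ?_) n
  obtain ⟨m, rfl⟩ : ∃ m, n = 5 * m + 4 := ⟨n / 5, by omega⟩
  have hC : (-15625 : PowerSeries ℚ) = C (-15625) := by rw [map_neg, map_ofNat]
  rw [coeff_eulerProduct_pow_fourteen, hC, coeff_C_mul, coeff_X_pow_mul']
  split_ifs with h1
  · rw [coeff_expand]
    split_ifs with h2
    · right
      -- A nonzero term needs m = 5l + 2, so n = 25l + 14; and -15625 = 25 · (-625).
      refine ⟨(m - 2) / 5, by omega, by omega, -625, ?_⟩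
      push_cast
      ring
    · simp
  · simp

end FiveDissection

/-! ### The arithmetic progressions and the four congruences -/

theorem odd_padicValNat_of_eq_pow_mul {p s M m : ℕ} [hp : Fact p.Prime] (hs : 1 ≤ s)
    (hM : M = p ^ (2 * s - 1) * m) (hm : ¬ p ∣ m) : Odd (padicValNat p M) := by
  have hm0 : m ≠ 0 := fun h => hm (h ▸ dvd_zero p)
  rw [hM, padicValNat.mul (pow_ne_zero _ hp.out.ne_zero) hm0, padicValNat.prime_pow,
    padicValNat.eq_zero_of_not_dvd hm]
  exact ⟨s - 1, by omega⟩

theorem not_dvd_of_isCoprime {p : ℕ} [hp : Fact p.Prime] {b : ℤ} (h : IsCoprime b p) :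
    ¬ (p : ℤ) ∣ b := fun hd =>
  (Nat.prime_iff_prime_int.mp hp.out).not_isUnit (h.isUnit_of_dvd' hd dvd_rfl)

/-- Used to see that the natural-number divisions by 4, 3 and 12 in the arguments are exact. -/
theorem pow_odd_mod {p m c s : ℕ} (h : p ^ 2 % m = 1 % m) (hs : 1 ≤ s) (hc : p % m = c) :
    p ^ (2 * s - 1) % m = c := by
  obtain ⟨s, rfl⟩ := Nat.exists_eq_add_of_le' hs
  rw [show 2 * (s + 1) - 1 = 2 * s + 1 by omega, pow_succ, pow_mul, Nat.mul_mod, Nat.pow_mod, h,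
    ← Nat.pow_mod, one_pow, ← Nat.mul_mod, one_mul, hc]

end FractionalPartition

theorem mainTheorem5 (k s : ℕ) (hk : 1 < k) (hs : 1 ≤ s) (hsk : s ≤ k / 2) :
    (∀ b : ℤ, IsCoprime b 3 → ∀ r ∈ ({1, 2} : Finset ℕ), ∀ n : ℕ,
      FractionalPartition.CongrZero
        (FractionalPartition.fracPartition (-(((3 : ℚ) ^ k - 6 * (b : ℚ)) / (b : ℚ)))
          (3 ^ (2 * s) * n + 3 ^ (2 * s - 1) * r + (3 ^ (2 * s) - 1) / 4))
        (3 ^ k)) ∧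
    (∀ b : ℤ, IsCoprime b 5 → ∀ r ∈ ({0, 2, 3, 4} : Finset ℕ), ∀ n : ℕ,
      FractionalPartition.CongrZero
        (FractionalPartition.fracPartition (-(((5 : ℚ) ^ k - 8 * (b : ℚ)) / (b : ℚ)))
          (5 ^ (2 * s) * n + 5 ^ (2 * s - 1) * r + (2 * 5 ^ (2 * s - 1) - 1) / 3))
        (5 ^ k)) ∧
    (∀ b : ℤ, IsCoprime b 5 → ∀ r ∈ ({0, 1, 3, 4} : Finset ℕ), ∀ n : ℕ,
      FractionalPartition.CongrZero
        (FractionalPartition.fracPartition (-(((5 : ℚ) ^ k - 14 * (b : ℚ)) / (b : ℚ)))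
          (5 ^ (2 * s) * n + 5 ^ (2 * s - 1) * r + (11 * 5 ^ (2 * s - 1) - 7) / 12))
        (5 ^ k)) ∧
    (∀ b : ℤ, IsCoprime b 7 → ∀ r ∈ ({0, 2, 3, 4, 5, 6} : Finset ℕ), ∀ n : ℕ,
      FractionalPartition.CongrZero
        (FractionalPartition.fracPartition (-(((7 : ℚ) ^ k - 6 * (b : ℚ)) / (b : ℚ)))
          (7 ^ (2 * s) * n + 7 ^ (2 * s - 1) * r + (3 * 7 ^ (2 * s - 1) - 1) / 4))
        (7 ^ k)) := by
  have : Fact (Nat.Prime 3) := ⟨Nat.prime_three⟩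
  have : Fact (Nat.Prime 5) := ⟨Nat.prime_five⟩
  have : Fact (Nat.Prime 7) := ⟨by norm_num⟩
  have hsucc (p : ℕ) : p ^ (2 * s) = p * p ^ (2 * s - 1) := by
    rw [← pow_succ', Nat.sub_add_cancel (by omega)]
  refine ⟨fun b hb r hr n => ?_, fun b hb r hr n => ?_, fun b hb r hr n => ?_,
    fun b hb r hr n => ?_⟩
  · have hm := FractionalPartition.pow_odd_mod (p := 3) (m := 4) (by norm_num) hs rfl
    have := FractionalPartition.congrZero_fracPartition (p := 3) (d := 6) (u := 4) (w := 1) (k := k)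
      (N := 3 ^ (2 * s) * n + 3 ^ (2 * s - 1) * r + (3 ^ (2 * s) - 1) / 4)
      (FractionalPartition.not_dvd_of_isCoprime hb) (by norm_num) (by norm_num)
      (FractionalPartition.coeff_eulerProduct_pow_six_eq_zero (by norm_num))
      (FractionalPartition.padicNorm_coeff_eulerProduct_pow_six_le (by norm_num))
      -- In each case uN + w is `p^(2s-1)` times this `m`, and the residue omitted from the list for
      -- `r` is the one making `m` divisible by `p`.
      (FractionalPartition.odd_padicValNat_of_eq_pow_mul (m := 12 * n + 4 * r + 3) hs ?_ ?_)
    · simpa only [Nat.cast_ofNat] using this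
    · rw [hsucc]
      have e : 4 * ((3 * 3 ^ (2 * s - 1) - 1) / 4) + 1 = 3 * 3 ^ (2 * s - 1) := by omega
      linear_combination e
    · fin_cases hr <;> omega
  · have hm := FractionalPartition.pow_odd_mod (p := 5) (m := 3) (by norm_num) hs rfl
    have := FractionalPartition.congrZero_fracPartition (p := 5) (d := 8) (u := 3) (w := 1) (k := k)
      (N := 5 ^ (2 * s) * n + 5 ^ (2 * s - 1) * r + (2 * 5 ^ (2 * s - 1) - 1) / 3)
      (FractionalPartition.not_dvd_of_isCoprime hb) (by norm_num) (by norm_num)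
      (fun n => (FractionalPartition.vanish_and_padicNorm_le_pow_eight n).1)
      (fun n => (FractionalPartition.vanish_and_padicNorm_le_pow_eight n).2)
      (FractionalPartition.odd_padicValNat_of_eq_pow_mul (m := 15 * n + 3 * r + 2) hs ?_ ?_)
    · simpa only [Nat.cast_ofNat] using this
    · rw [hsucc]
      have e : 3 * ((2 * 5 ^ (2 * s - 1) - 1) / 3) + 1 = 2 * 5 ^ (2 * s - 1) := by omega
      linear_combination e
    · fin_cases hr <;> omega
  · have hm := FractionalPartition.pow_odd_mod (p := 5) (m := 12) (by norm_num) hs rfl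
    have := FractionalPartition.congrZero_fracPartition (p := 5) (d := 14) (u := 12) (w := 7)
      (k := k) (N := 5 ^ (2 * s) * n + 5 ^ (2 * s - 1) * r + (11 * 5 ^ (2 * s - 1) - 7) / 12)
      (FractionalPartition.not_dvd_of_isCoprime hb) (by norm_num) (by norm_num)
      (fun n => (FractionalPartition.vanish_and_padicNorm_le_pow_fourteen n).1)
      (fun n => (FractionalPartition.vanish_and_padicNorm_le_pow_fourteen n).2)
      (FractionalPartition.odd_padicValNat_of_eq_pow_mul (m := 60 * n + 12 * r + 11) hs ?_ ?_)
    · simpa only [Nat.cast_ofNat] using this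
    · rw [hsucc]
      have e : 12 * ((11 * 5 ^ (2 * s - 1) - 7) / 12) + 7 = 11 * 5 ^ (2 * s - 1) := by omega
      linear_combination e
    · fin_cases hr <;> omega
  · have hm := FractionalPartition.pow_odd_mod (p := 7) (m := 4) (by norm_num) hs rfl
    have := FractionalPartition.congrZero_fracPartition (p := 7) (d := 6) (u := 4) (w := 1) (k := k)
      (N := 7 ^ (2 * s) * n + 7 ^ (2 * s - 1) * r + (3 * 7 ^ (2 * s - 1) - 1) / 4)
      (FractionalPartition.not_dvd_of_isCoprime hb) (by norm_num) (by norm_num)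
      (FractionalPartition.coeff_eulerProduct_pow_six_eq_zero (by norm_num))
      (FractionalPartition.padicNorm_coeff_eulerProduct_pow_six_le (by norm_num))
      (FractionalPartition.odd_padicValNat_of_eq_pow_mul (m := 28 * n + 4 * r + 3) hs ?_ ?_)
    · simpa only [Nat.cast_ofNat] using this
    · rw [hsucc]
      have e : 4 * ((3 * 7 ^ (2 * s - 1) - 1) / 4) + 1 = 3 * 7 ^ (2 * s - 1) := by omega
      linear_combination e
    · fin_cases hr <;> omega
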